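/- Let $d\ge 2$ be an integer and let $\mathbb B$ be the rooted regular $d$-ary tree, with root $0$; write $|x|$ for the generation of a vertex $x$, so $|0|=0$, and $y\le x$ if $y$ is an ancestor of $x$ or $y=x$. Let $(U_x)_{x\in\mathbb B}$ be i.i.d. exponential random variables with mean one on a probability space. For $\alpha\in(0,1)$ set $$T_\alpha(x)=\sum_{y\le x}\alpha^{|y|}U_y\quad(x\in\mathbb B),\qquad C_\alpha(t)=\{x\in\mathbb B: T_\alpha(x)\le t\}\quad(t\ge 0),$$ and let $$T_\alpha(\infty)=\lim_{n\to\infty}\,\inf\{t\ge 0:\ \#C_\alpha(t)\ge n\}\in[0,\infty]$$ be the time to percolate to infinity. (The same variables $U_x$ are used for all $\alpha$.) Theorem 8.2. The equation $d\,c\,e^{1-c}=1$ has exactly one root $c=c_{8.1}(d)$ in $(0,1)$. Almost surely $T_\alpha(\infty)<\infty$ for all $\alpha\in(0,1)$, each $T_\alpha(\infty)$ is integrable, and $$(1-\alpha)\,T_\alpha(\infty)\longrightarrow c_{8.1}(d)\qquad\text{as }\alpha\uparrow 1,$$ almost surely and in $L^1$. -/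

import Mathlib

open MeasureTheory ProbabilityTheory Filter Topology
open scoped NNReal ENNReal

noncomputable section

namespace TreePercolation

/-- Vertices of the rooted regular `d`-ary tree: finite words over an alphabet of `d` letters.
The root is the empty word, the generation `|x|` of `x` is its length, and the ancestors of `x`
(including `x` itself) are its initial segments `x.take k`, `k = 0, …, |x|`. -/
abbrev Vertex (d : ℕ) : Type := List (Fin d)

/-- The time `T_α(x) = ∑_{y ≤ x} α^{|y|} U_y` at which `x` gets wet; the sum is over all
ancestors `y` of `x`, including the root and `x`. -/
def passageTime {d : ℕ} (U : Vertex d → ℝ) (α : ℝ) (x : Vertex d) : ℝ :=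
  ∑ k ∈ Finset.range (x.length + 1), α ^ k * U (x.take k)

/-- The cluster `C(t) = {x : T_α(x) ≤ t}` of vertices that are wet at time `t`. -/
def cluster {d : ℕ} (U : Vertex d → ℝ) (α t : ℝ) : Set (Vertex d) :=
  {x | passageTime U α x ≤ t}

/-- The first time `t ≥ 0` at which the cluster has (at least) `n` vertices; it is `∞` if this
never happens. Where no two passage times coincide (almost surely, for fixed `α`) vertices get
wet one at a time, and "at least `n`" is the same as "exactly `n`". The form with "at least" is
also meaningful for the random exceptional values of `α` at which two vertices get wet at the
same moment. -/
def growthTime {d : ℕ} (U : Vertex d → ℝ) (α : ℝ) (n : ℕ) : ℝ≥0∞ :=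
  ⨅ (t : ℝ≥0) (_ : (n : ℕ∞) ≤ (cluster U α t).encard), (t : ℝ≥0∞)

/-- The time `T_α(∞) ∈ [0, ∞]` to percolate to infinity: the limit, equivalently the supremum,
of the nondecreasing sequence of growth times. -/
def timeToInfinity {d : ℕ} (U : Vertex d → ℝ) (α : ℝ) : ℝ≥0∞ :=
  ⨆ n : ℕ, growthTime U α n

theorem growthTime_mono {d : ℕ} (U : Vertex d → ℝ) (α : ℝ) : Monotone (growthTime U α) := by
  intro m n h
  have h' : (m : ℕ∞) ≤ (n : ℕ∞) := by exact_mod_cast h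
  unfold growthTime
  exact le_iInf₂ fun t ht => iInf₂_le_of_le t (h'.trans ht) le_rfl

theorem tendsto_growthTime {d : ℕ} (U : Vertex d → ℝ) (α : ℝ) :
    Tendsto (growthTime U α) atTop (𝓝 (timeToInfinity U α)) :=
  tendsto_atTop_iSup (growthTime_mono U α)

/-- `c` is a root in `(0, 1)` of `d c e^{1 - c} = 1`. -/
def IsSpeedRoot (d : ℕ) (c : ℝ) : Prop :=
  0 < c ∧ c < 1 ∧ (d : ℝ) * c * Real.exp (1 - c) = 1

end TreePercolation

end

noncomputable section

namespace TreePercolation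

variable {d : ℕ}

/-! The constant `c` is the speed of the first-birth problem for the undiscounted tree: the least
label sum over paths of `n` vertices is about `c * n`. About `d ^ n` paths compete, and one of them
has sum at most `b * n` with probability roughly `(b * exp (1 - b)) ^ n`, so the critical `b < 1`
solves `d * b * exp (1 - b) = 1`.

The discount factor enters only deterministically. As `α ^ k` decreases in `k`, summation by parts
turns linear bounds with slope `b` and additive error `K` on all partial sums into the same bounds
on discounted sums, with `b * n` replaced by `b` times a geometric sum (`passageTime_le`,
`le_passageTime`). Multiplication by `1 - α` then makes `K` disappear as `α` tends to 1. Since `K`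
does not depend on `α`, one null set serves every `α`.

Lower bound (`ae_exists_le_pathSum`): Chernoff, a union bound and Borel–Cantelli. Upper bound
(`ae_exists_hasSlowPaths`): for `b > c`, long blocks with sum at most `b * m` form a supercritical
branching process, which survives with positive probability; almost surely it survives from some
vertex. For convergence in `L¹`, a single fixed ray supplies an integrable dominating variable
(`exists_integrable_hasSlowPaths`). -/

/-! ### Path sums and summation by parts -/

/-- The sum of the first `n` labels along the path from the root to `x`. -/
def pathSum (u : Vertex d → ℝ) (x : Vertex d) (n : ℕ) : ℝ :=
  ∑ k ∈ Finset.range n, u (x.take k)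

/-- The labels seen from the vertex `y`. -/
def shift (y : Vertex d) (u : Vertex d → ℝ) : Vertex d → ℝ := fun x => u (y ++ x)

theorem pathSum_append_add (u : Vertex d → ℝ) (y z : Vertex d) (n : ℕ) :
    pathSum u (y ++ z) (y.length + n) = pathSum u y y.length + pathSum (shift y u) z n := by
  unfold pathSum shift
  rw [Finset.sum_range_add]
  congr 1
  · refine Finset.sum_congr rfl fun k hk => ?_
    rw [List.take_append_of_le_length (Finset.mem_range.1 hk).le]
  · refine Finset.sum_congr rfl fun k _ => ?_
    rw [List.take_length_add_append]

theorem pathSum_append_of_le (u : Vertex d → ℝ) (y z : Vertex d) {n : ℕ} (hn : n ≤ y.length) :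
    pathSum u (y ++ z) n = pathSum u y n := by
  refine Finset.sum_congr rfl fun k hk => ?_
  rw [List.take_append_of_le_length ((Finset.mem_range.1 hk).le.trans hn)]

theorem pathSum_mono {u : Vertex d → ℝ} (hu : ∀ x, 0 ≤ u x) (x : Vertex d) :
    Monotone (pathSum u x) := fun _ _ h =>
  Finset.sum_le_sum_of_subset_of_nonneg (Finset.range_mono h) fun _ _ _ => hu _

theorem pathSum_nonneg {u : Vertex d → ℝ} (hu : ∀ x, 0 ≤ u x) (x : Vertex d) (n : ℕ) :
    0 ≤ pathSum u x n := Finset.sum_nonneg fun _ _ => hu _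

theorem pathSum_take (u : Vertex d → ℝ) (x : Vertex d) {n N : ℕ} (h : n ≤ N + 1) :
    pathSum u (x.take N) n = pathSum u x n := by
  refine Finset.sum_congr rfl fun k hk => ?_
  have := Finset.mem_range.1 hk
  rw [List.take_take, min_eq_left (by omega)]

/-- Summation by parts as an induction: lowering the weight of a nonnegative partial sum from `w N`
to `w (N + 1)` can only decrease the product. -/
theorem mul_sum_le_sum_mul {w c : ℕ → ℝ} (hw : Antitone w) {N : ℕ}
    (hc : ∀ n ≤ N, 0 ≤ ∑ k ∈ Finset.range n, c k) :
    w N * ∑ k ∈ Finset.range N, c k ≤ ∑ k ∈ Finset.range N, w k * c k := by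
  induction N with
  | zero => simp
  | succ N ih =>
    have h1 := ih fun n hn => hc n (by omega)
    have h2 := hc (N + 1) le_rfl
    calc w (N + 1) * ∑ k ∈ Finset.range (N + 1), c k
        ≤ w N * ∑ k ∈ Finset.range (N + 1), c k :=
          mul_le_mul_of_nonneg_right (hw (Nat.le_succ N)) h2
      _ = w N * ∑ k ∈ Finset.range N, c k + w N * c N := by rw [Finset.sum_range_succ]; ring
      _ ≤ _ := by rw [Finset.sum_range_succ _ N]; linarith

theorem sum_mul_le_sum_mul_of_partial_sums_le {w a b : ℕ → ℝ} (hw : Antitone w)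
    {N : ℕ} (hw0 : 0 ≤ w N)
    (h : ∀ n ≤ N, ∑ k ∈ Finset.range n, a k ≤ ∑ k ∈ Finset.range n, b k) :
    ∑ k ∈ Finset.range N, w k * a k ≤ ∑ k ∈ Finset.range N, w k * b k := by
  have hc : ∀ n ≤ N, 0 ≤ ∑ k ∈ Finset.range n, (b k - a k) := fun n hn => by
    rw [Finset.sum_sub_distrib]; linarith [h n hn]
  have := (mul_nonneg hw0 (hc N le_rfl)).trans (mul_sum_le_sum_mul hw hc)
  simp only [mul_sub, Finset.sum_sub_distrib] at this
  linarith

theorem sum_range_add_single (K b : ℝ) (n : ℕ) :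
    ∑ k ∈ Finset.range (n + 1), (b + if k = 0 then K else 0) = K + b * (n + 1 : ℕ) := by
  rw [Finset.sum_add_distrib, Finset.sum_ite_eq' (Finset.range (n + 1)) 0]
  simp
  ring

theorem sum_range_pow_mul_add_single (K b α : ℝ) (n : ℕ) :
    ∑ k ∈ Finset.range (n + 1), α ^ k * (b + if k = 0 then K else 0) =
      K + b * ∑ k ∈ Finset.range (n + 1), α ^ k := by
  simp only [mul_add, Finset.sum_add_distrib, mul_ite, mul_zero]
  rw [Finset.sum_ite_eq' (Finset.range (n + 1)) 0, ← Finset.sum_mul]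
  simp
  ring

theorem geom_sum_le_inv {α : ℝ} (h0 : 0 ≤ α) (h1 : α < 1) (n : ℕ) :
    ∑ k ∈ Finset.range n, α ^ k ≤ (1 - α)⁻¹ := by
  rw [← tsum_geometric_of_lt_one h0 h1]
  exact (summable_geometric_of_lt_one h0 h1).sum_le_tsum _ fun _ _ => pow_nonneg h0 _

theorem passageTime_le {u : Vertex d → ℝ} {α K b : ℝ} (h0 : 0 ≤ α) (h1 : α < 1) (hb : 0 ≤ b)
    {x : Vertex d} (h : ∀ n ≤ x.length + 1, pathSum u x n ≤ K + b * n) :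
    passageTime u α x ≤ K + b / (1 - α) := by
  -- The constant `K` is charged to the root, where the weight is `α ^ 0 = 1`, so it survives
  -- discounting unchanged. The empty sum does not contain it, hence the separate case `n = 0`.
  have key := sum_mul_le_sum_mul_of_partial_sums_le (w := fun k => α ^ k)
    (a := fun k => u (x.take k)) (b := fun k => b + if k = 0 then K else 0) (N := x.length + 1)
    (pow_right_anti₀ h0 h1.le) (pow_nonneg h0 _) (fun n hn => by
      rcases n with _ | n
      · simp
      · rw [sum_range_add_single]; exact h _ hn)
  rw [sum_range_pow_mul_add_single] at key
  refine key.trans ?_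
  rw [div_eq_mul_inv]
  gcongr
  exact geom_sum_le_inv h0 h1 _

theorem le_passageTime {u : Vertex d → ℝ} {α K a : ℝ} (h0 : 0 ≤ α) (h1 : α < 1)
    {x : Vertex d} (h : ∀ n ≤ x.length + 1, a * n - K ≤ pathSum u x n) :
    a * ∑ k ∈ Finset.range (x.length + 1), α ^ k - K ≤ passageTime u α x := by
  have key := sum_mul_le_sum_mul_of_partial_sums_le (w := fun k => α ^ k)
    (b := fun k => u (x.take k)) (a := fun k => a + if k = 0 then -K else 0) (N := x.length + 1)
    (pow_right_anti₀ h0 h1.le) (pow_nonneg h0 _) (fun n hn => by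
      rcases n with _ | n
      · simp
      · rw [sum_range_add_single]; have := h _ hn; simp only [pathSum] at this; linarith)
  rw [sum_range_pow_mul_add_single] at key
  unfold passageTime
  linarith

/-! ### From passage times to the time to infinity -/

theorem timeToInfinity_le {u : Vertex d → ℝ} {α t : ℝ}
    (h : ∀ N, ∃ x : Vertex d, x.length = N ∧ passageTime u α x ≤ t) (ht : 0 ≤ t) :
    timeToInfinity u α ≤ ENNReal.ofReal t := by
  choose x hx hxt using h
  have hinj : Function.Injective x := fun m n hmn => by rw [← hx m, ← hx n, hmn]
  refine iSup_le fun n => iInf₂_le_of_le t.toNNReal ?_ le_rfl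
  have hinf : (cluster u α (t.toNNReal : ℝ)).Infinite := by
    refine (Set.infinite_range_of_injective hinj).mono ?_
    rintro _ ⟨N, rfl⟩
    simpa [cluster, Real.coe_toNNReal t ht] using hxt N
  rw [hinf.encard_eq]
  exact le_top

/-- Only finitely many vertices lie below generation `N`, so a larger cluster contains a vertex of
generation at least `N`, which gets wet late. Then `N` tends to infinity. -/
theorem le_timeToInfinity {u : Vertex d → ℝ} {α K a : ℝ} (h0 : 0 ≤ α) (h1 : α < 1) (ha : 0 ≤ a)
    (h : ∀ x : Vertex d, a * ∑ k ∈ Finset.range (x.length + 1), α ^ k - K ≤ passageTime u α x) :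
    ENNReal.ofReal (a / (1 - α) - K) ≤ timeToInfinity u α := by
  have hlim : Tendsto (fun N => ENNReal.ofReal (a * ∑ k ∈ Finset.range (N + 1), α ^ k - K)) atTop
      (𝓝 (ENNReal.ofReal (a / (1 - α) - K))) := by
    refine ENNReal.tendsto_ofReal ?_
    rw [div_eq_mul_inv]
    exact (((hasSum_geometric_of_lt_one h0 h1).tendsto_sum_nat.comp
      (tendsto_add_atTop_nat 1)).const_mul a).sub_const K
  refine le_of_tendsto' hlim fun N => ?_
  have hfin : {x : Vertex d | x.length < N}.Finite := List.finite_length_lt _ _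
  refine le_trans ?_ (le_iSup _ (hfin.toFinset.card + 1))
  refine le_iInf₂ fun t ht => ?_
  obtain ⟨x, hx, hxN⟩ : ∃ x ∈ cluster u α t, ¬ x.length < N := by
    by_contra! hcon
    have := ht.trans (Set.encard_le_encard (t := {x : Vertex d | x.length < N}) hcon)
    rw [hfin.encard_eq_coe_toFinset_card] at this
    have h' : hfin.toFinset.card + 1 ≤ hfin.toFinset.card := by exact_mod_cast this
    omega
  rw [← ENNReal.ofReal_coe_nnreal]
  refine ENNReal.ofReal_le_ofReal (le_trans ?_ ((h x).trans hx))
  gcongr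
  omega

/-- Replaces the uncountable infimum over times by one over the countably many finite vertex sets,
which yields measurability. -/
theorem growthTime_eq_iInf (u : Vertex d → ℝ) (α : ℝ) (n : ℕ) :
    growthTime u α n = ⨅ (F : Finset (Vertex d)) (_ : F.card = n),
      F.sup fun x => ENNReal.ofReal (passageTime u α x) := by
  refine le_antisymm (le_iInf₂ fun F hF => ?_) (le_iInf₂ fun t ht => ?_)
  · refine iInf₂_le_of_le (F.sup fun x => (passageTime u α x).toNNReal) ?_ ?_
    · rw [← hF, ← Set.encard_coe_eq_coe_finsetCard]
      refine Set.encard_le_encard fun x hx => ?_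
      have : (passageTime u α x).toNNReal ≤ F.sup fun x => (passageTime u α x).toNNReal :=
        Finset.le_sup (f := fun x => (passageTime u α x).toNNReal) hx
      exact (Real.le_coe_toNNReal _).trans (NNReal.coe_le_coe.2 this)
    · rcases F.eq_empty_or_nonempty with rfl | hne
      · simp
      · obtain ⟨x, hx, hxs⟩ := F.exists_mem_eq_sup hne fun x => (passageTime u α x).toNNReal
        rw [hxs]
        exact Finset.le_sup (f := fun x => ENNReal.ofReal (passageTime u α x)) hx
  · obtain ⟨S, hS, hcard⟩ := Set.exists_subset_encard_eq ht
    have hfin : S.Finite := Set.finite_of_encard_eq_coe hcard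
    refine iInf₂_le_of_le hfin.toFinset ?_ (Finset.sup_le fun x hx => ?_)
    · rw [hfin.encard_eq_coe_toFinset_card] at hcard
      exact_mod_cast hcard
    · have : passageTime u α x ≤ t := hS (hfin.mem_toFinset.1 hx)
      rw [← ENNReal.ofReal_coe_nnreal]
      exact ENNReal.ofReal_le_ofReal this

@[fun_prop]
theorem measurable_passageTime (α : ℝ) (x : Vertex d) :
    Measurable fun u : Vertex d → ℝ => passageTime u α x := by
  unfold passageTime
  fun_prop

@[fun_prop]
theorem measurable_pathSum (x : Vertex d) (n : ℕ) :
    Measurable fun u : Vertex d → ℝ => pathSum u x n := by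
  unfold pathSum
  fun_prop

@[fun_prop]
theorem measurable_shift (y : Vertex d) : Measurable (shift y) :=
  measurable_pi_iff.2 fun _ => measurable_pi_apply _

theorem measurable_timeToInfinity (α : ℝ) :
    Measurable fun u : Vertex d → ℝ => timeToInfinity u α := by
  refine Measurable.iSup fun n => ?_
  simp only [growthTime_eq_iInf]
  refine Measurable.iInf fun F => Measurable.iInf fun _ => ?_
  simp only [Finset.sup_eq_iSup]
  exact Measurable.iSup fun x => Measurable.iSup fun _ => (measurable_passageTime α x).ennreal_ofReal

/-! ### The exponential law -/

instance : IsProbabilityMeasure (expMeasure 1) := isProbabilityMeasure_expMeasure one_pos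

theorem ae_nonneg_expMeasure : ∀ᵐ x ∂expMeasure 1, 0 ≤ x := by
  have : expMeasure 1 (Set.Iio 0) = 0 := by
    rw [expMeasure, gammaMeasure, withDensity_apply _ measurableSet_Iio]
    exact lintegral_exponentialPDF_of_nonpos le_rfl
  rw [ae_iff]
  simpa [Set.Iio] using this

theorem integral_expMeasure (f : ℝ → ℝ) :
    ∫ x, f x ∂expMeasure 1 = ∫ x in Set.Ici 0, Real.exp (-x) * f x := by
  have hm : Measurable (gammaPDF 1 1) := (measurable_exponentialPDFReal 1).ennreal_ofReal
  rw [expMeasure, gammaMeasure, integral_withDensity_eq_integral_toReal_smul hm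
    (ae_of_all _ fun _ => ENNReal.ofReal_lt_top), ← integral_indicator measurableSet_Ici]
  congr 1
  ext x
  have h := exponentialPDF_eq 1 x
  rw [exponentialPDF, exponentialPDFReal] at h
  rw [gammaPDF, h]
  by_cases hx : 0 ≤ x
  · simp [hx, (Real.exp_pos _).le]
  · simp [hx]

theorem mgf_id_expMeasure {s : ℝ} (hs : s < 1) : mgf id (expMeasure 1) s = (1 - s)⁻¹ := by
  rw [mgf, integral_expMeasure, integral_Ici_eq_integral_Ioi]
  have h := integral_exp_mul_Ioi (a := s - 1) (by linarith) 0
  simp only [id, ← Real.exp_add]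
  have h2 : ∀ x : ℝ, -x + s * x = (s - 1) * x := fun x => by ring
  simp only [h2, h]
  rw [mul_zero, Real.exp_zero, ← neg_sub 1 s, neg_div_neg_eq, one_div]

theorem intervalIntegral_le_integral_expMeasure {f g : ℝ → ℝ} {t : ℝ} (ht : 0 ≤ t)
    (hf : Measurable f) (hf0 : ∀ x, 0 ≤ f x) (hf1 : ∀ x, f x ≤ 1) (hg : Continuous g)
    (hgf : ∀ x, 0 ≤ x → x ≤ t → g x ≤ f x) :
    ∫ r in 0..t, Real.exp (-r) * g r ≤ ∫ r, f r ∂expMeasure 1 := by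
  have hint : IntegrableOn (fun r => Real.exp (-r) * f r) (Set.Ioi 0) := by
    have h1 : IntegrableOn (fun r : ℝ => Real.exp (-r)) (Set.Ioi 0) := by
      simpa using exp_neg_integrableOn_Ioi 0 one_pos
    refine Integrable.mono' h1 (by fun_prop) (ae_of_all _ fun r => ?_)
    rw [Real.norm_of_nonneg (mul_nonneg (Real.exp_pos _).le (hf0 r))]
    exact mul_le_of_le_one_right (Real.exp_pos _).le (hf1 r)
  rw [integral_expMeasure, integral_Ici_eq_integral_Ioi, intervalIntegral.integral_of_le ht]
  calc ∫ r in Set.Ioc 0 t, Real.exp (-r) * g r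
      ≤ ∫ r in Set.Ioc 0 t, Real.exp (-r) * f r := by
        refine setIntegral_mono_on ?_ (hint.mono_set Set.Ioc_subset_Ioi_self) measurableSet_Ioc ?_
        · exact (Continuous.integrableOn_Icc (by fun_prop)).mono_set Set.Ioc_subset_Icc_self
        · intro r hr
          exact mul_le_mul_of_nonneg_left (hgf r hr.1.le hr.2) (Real.exp_pos _).le
    _ ≤ _ := by
        refine setIntegral_mono_set hint (ae_of_all _ fun r => ?_)
          Set.Ioc_subset_Ioi_self.eventuallyLE
        exact mul_nonneg (Real.exp_pos _).le (hf0 r)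

/-! ### The law of the labelled tree and its branching property -/

/-- The law of a family of i.i.d. exponential variables of mean one indexed by the tree. -/
def treeMeasure (d : ℕ) : Measure (Vertex d → ℝ) := Measure.infinitePi fun _ => expMeasure 1

instance (d : ℕ) : IsProbabilityMeasure (treeMeasure d) := by unfold treeMeasure; infer_instance

/-- The labelling of the tree with a given label at the root and given labellings of the `d`
subtrees rooted at generation one. -/
def assemble (p : ℝ × (Fin d → Vertex d → ℝ)) : Vertex d → ℝ
  | [] => p.1
  | i :: x => p.2 i x

theorem measurable_assemble : Measurable (assemble (d := d)) := by
  refine measurable_pi_iff.2 fun x => ?_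
  cases x with
  | nil => exact measurable_fst
  | cons i x =>
    exact (measurable_pi_apply x).comp ((measurable_pi_apply i).comp measurable_snd)

theorem shift_assemble (p : ℝ × (Fin d → Vertex d → ℝ)) (i : Fin d) :
    shift [i] (assemble p) = p.2 i := rfl

theorem prod_eq_mul_prod_prod_cons [DecidableEq (Vertex d)] (s : Finset (Vertex d))
    (f : Vertex d → ℝ≥0∞) :
    ∏ x ∈ s, f x = (if [] ∈ s then f [] else 1) *
      ∏ i, ∏ x ∈ s.preimage (List.cons i) (List.cons_injective.injOn), f (i :: x) := by
  rw [← Finset.prod_fiberwise s List.head?, Fintype.prod_option]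
  congr 1
  · simp only [List.head?_eq_none_iff, Finset.prod_filter, Finset.prod_ite_eq']
  · refine Finset.prod_congr rfl fun i _ => ?_
    refine (Finset.prod_bij (fun x _ => i :: x) ?_ ?_ ?_ ?_).symm
    · intro x hx; simpa using hx
    · intro x _ y _ h; exact List.cons_injective h
    · intro x hx
      rw [Finset.mem_filter, List.head?_eq_some_iff] at hx
      obtain ⟨hx, y, rfl⟩ := hx
      exact ⟨y, by simpa using hx, rfl⟩
    · intros; rfl

/-- The branching property: root label and the `d` labelled subtrees are independent, each subtree
distributed as the whole tree. It is checked on boxes, whose product splits according to the first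
letter. -/
theorem map_assemble :
    ((expMeasure 1).prod (Measure.pi fun _ : Fin d => treeMeasure d)).map assemble
      = treeMeasure d := by
  classical
  refine Measure.eq_infinitePi _ fun s t ht => ?_
  rw [Measure.map_apply measurable_assemble
    (MeasurableSet.pi s.countable_toSet fun x _ => ht x)]
  have : assemble ⁻¹' (Set.pi s t) = (if [] ∈ s then t [] else Set.univ) ×ˢ
      Set.univ.pi fun i => Set.pi (s.preimage (List.cons i) (List.cons_injective.injOn))
        fun x => t (i :: x) := by
    ext p
    simp only [Set.mem_preimage, Set.mem_pi, Finset.mem_coe, Set.mem_prod, Set.mem_univ,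
      true_imp_iff, Finset.mem_preimage]
    constructor
    · refine fun h => ⟨?_, fun i x hx => h (i :: x) hx⟩
      split_ifs with h0
      · exact h [] h0
      · trivial
    · rintro ⟨h1, h2⟩ x hx
      cases x with
      | nil => rw [if_pos hx] at h1; exact h1
      | cons i x => exact h2 i x hx
  rw [this, Measure.prod_prod, Measure.pi_pi, prod_eq_mul_prod_prod_cons]
  congr 1
  · split_ifs <;> simp
  · refine Finset.prod_congr rfl fun i _ => ?_
    rw [treeMeasure, Measure.infinitePi_pi]
    exact fun x _ => ht (i :: x)

theorem map_eval_treeMeasure (x : Vertex d) :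
    (treeMeasure d).map (fun u => u x) = expMeasure 1 :=
  Measure.infinitePi_map_eval _ x

theorem ae_nonneg_treeMeasure : ∀ᵐ u ∂treeMeasure d, ∀ x, 0 ≤ u x := by
  refine ae_all_iff.2 fun x => ?_
  have h := ae_nonneg_expMeasure
  rw [← map_eval_treeMeasure x] at h
  exact ae_of_ae_map (measurable_pi_apply x).aemeasurable h

theorem iIndepFun_eval_treeMeasure :
    iIndepFun (fun (x : Vertex d) (u : Vertex d → ℝ) => u x) (treeMeasure d) :=
  iIndepFun_infinitePi (X := fun _ => id) fun _ => measurable_id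

theorem mgf_pathSum {s : ℝ} (hs : s < 1) {x : Vertex d} {n : ℕ} (hn : n ≤ x.length + 1) :
    mgf (fun u => pathSum u x n) (treeMeasure d) s = ((1 - s)⁻¹) ^ n := by
  have hinj : Function.Injective fun k : Fin n => x.take k := by
    intro k l h
    have := congrArg List.length h
    simp only [List.length_take] at this
    ext
    omega
  have h1 := (iIndepFun_eval_treeMeasure.precomp hinj).mgf_sum (t := s)
    (fun _ => measurable_pi_apply _) Finset.univ
  have h2 : ∀ y : Vertex d, mgf (fun u : Vertex d → ℝ => u y) (treeMeasure d) s = (1 - s)⁻¹ := by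
    intro y
    rw [← mgf_id_expMeasure hs, ← map_eval_treeMeasure y, mgf_id_map (measurable_pi_apply y).aemeasurable]
  have h3 : (fun u : Vertex d → ℝ => pathSum u x n) =
      ∑ k : Fin n, fun u : Vertex d → ℝ => u (x.take k) := by
    ext u
    rw [Finset.sum_apply, pathSum, Finset.sum_range]
  rw [h3, h1]
  simp [h2]

theorem integrable_exp_mul_pathSum {s : ℝ} (hs : s < 1) {x : Vertex d} {n : ℕ}
    (hn : n ≤ x.length + 1) :
    Integrable (fun u => Real.exp (s * pathSum u x n)) (treeMeasure d) := by
  -- A non-integrable function has integral 0 by convention, but the computed moment generating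
  -- function is positive.
  by_contra h
  have h1 := mgf_pathSum hs hn
  rw [mgf, integral_undef h] at h1
  have : 0 < (1 - s)⁻¹ := inv_pos.2 (by linarith)
  exact absurd h1 (pow_pos this n).ne

/-! ### Survival of the branching process of cheap blocks -/

/-- Some path of `n` vertices starting at the root has total label at most `t`, and continues to a
child of its last vertex from which the labelling has the property `A`. -/
def Reach (A : Set (Vertex d → ℝ)) (n : ℕ) (t : ℝ) (u : Vertex d → ℝ) : Prop :=
  ∃ x : Vertex d, x.length = n ∧ pathSum u x n ≤ t ∧ shift x u ∈ A

theorem reach_zero (A : Set (Vertex d → ℝ)) (t : ℝ) (u : Vertex d → ℝ) :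
    Reach A 0 t u ↔ 0 ≤ t ∧ u ∈ A := by
  constructor
  · rintro ⟨x, hx, h, hA⟩
    obtain rfl := List.length_eq_zero_iff.1 hx
    exact ⟨by simpa [pathSum] using h, hA⟩
  · rintro ⟨h, hA⟩
    exact ⟨[], rfl, by simpa [pathSum] using h, hA⟩

theorem pathSum_cons (u : Vertex d → ℝ) (i : Fin d) (x : Vertex d) (n : ℕ) :
    pathSum u (i :: x) (n + 1) = u [] + pathSum (shift [i] u) x n := by
  rw [pathSum, Finset.sum_range_succ', add_comm]
  rfl

theorem reach_succ (A : Set (Vertex d → ℝ)) (n : ℕ) (t : ℝ) (u : Vertex d → ℝ) :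
    Reach A (n + 1) t u ↔ ∃ i, Reach A n (t - u []) (shift [i] u) := by
  constructor
  · rintro ⟨x, hx, h, hA⟩
    obtain ⟨i, x, rfl⟩ := List.exists_cons_of_length_eq_add_one hx
    rw [pathSum_cons] at h
    exact ⟨i, x, by simpa using hx, by linarith, hA⟩
  · rintro ⟨i, x, hx, h, hA⟩
    refine ⟨i :: x, by simp [hx], ?_, hA⟩
    rw [pathSum_cons]
    linarith

theorem measurableSet_reach {A : Set (Vertex d → ℝ)} (hA : MeasurableSet A) (n : ℕ) :
    MeasurableSet {p : ℝ × (Vertex d → ℝ) | Reach A n p.1 p.2} := by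
  have : {p : ℝ × (Vertex d → ℝ) | Reach A n p.1 p.2} = ⋃ (x : Vertex d) (_ : x.length = n),
      {p | pathSum p.2 x n ≤ p.1} ∩ (fun p => shift x p.2) ⁻¹' A := by
    ext p
    simp only [Reach, Set.mem_ofPred_eq, Set.mem_iUnion, Set.mem_inter_iff, Set.mem_preimage,
      exists_prop]
  rw [this]
  refine MeasurableSet.iUnion fun x => MeasurableSet.iUnion fun _ => ?_
  exact (measurableSet_le ((measurable_pathSum x n).comp measurable_snd) measurable_fst).inter
    (((measurable_shift x).comp measurable_snd) hA)

theorem measurableSet_reach_right {A : Set (Vertex d → ℝ)} (hA : MeasurableSet A) (n : ℕ) (t : ℝ) :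
    MeasurableSet {u : Vertex d → ℝ | Reach A n t u} :=
  measurable_prodMk_left (measurableSet_reach hA n)

theorem measurable_treeMeasure_reach {A : Set (Vertex d → ℝ)} (hA : MeasurableSet A) (n : ℕ) :
    Measurable fun t => (treeMeasure d).real {u | Reach A n t u} :=
  (measurable_measure_prodMk_left (measurableSet_reach hA n)).ennreal_toReal

/-- Conditionally on the root label `r`, the event fails exactly when it fails in all `d`
independent subtrees. -/
theorem treeMeasure_eq_integral {B : Set (ℝ × (Vertex d → ℝ))} (hB : MeasurableSet B) (t : ℝ) :
    (treeMeasure d).real {u | ∃ i, (t - u [], shift [i] u) ∈ B} =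
      ∫ r, (1 - (1 - (treeMeasure d).real {u | (t - r, u) ∈ B}) ^ d) ∂expMeasure 1 := by
  have hsec : ∀ s, MeasurableSet {u | (s, u) ∈ B} := fun s => measurable_prodMk_left hB
  have hS : MeasurableSet {u : Vertex d → ℝ | ∃ i, (t - u [], shift [i] u) ∈ B} := by
    simp only [Set.ofPred_exists]
    refine MeasurableSet.iUnion fun i => ?_
    exact ((measurable_const.sub (measurable_pi_apply [])).prodMk (measurable_shift [i])) hB
  have hT : MeasurableSet (assemble ⁻¹' {u : Vertex d → ℝ | ∃ i, (t - u [], shift [i] u) ∈ B}) :=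
    measurable_assemble hS
  conv_lhs => rw [← map_assemble, measureReal_def, Measure.map_apply measurable_assemble hS,
    Measure.prod_apply hT]
  rw [← integral_toReal (measurable_measure_prodMk_left hT).aemeasurable
    (ae_of_all _ fun _ => measure_lt_top _ _)]
  congr 1
  ext r
  have : Prod.mk r ⁻¹' (assemble ⁻¹' {u : Vertex d → ℝ | ∃ i, (t - u [], shift [i] u) ∈ B}) =
      (Set.univ.pi fun _ : Fin d => {u | (t - r, u) ∈ B}ᶜ)ᶜ := by
    ext v
    simp only [Set.mem_preimage, Set.mem_ofPred_eq, shift_assemble, assemble, Set.mem_compl_iff,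
      Set.mem_pi, Set.mem_univ, true_imp_iff, not_forall, not_not]
  rw [← measureReal_def, this, probReal_compl_eq_one_sub
    (MeasurableSet.univ_pi fun _ => (hsec _).compl), measureReal_def, Measure.pi_pi]
  simp only [Finset.prod_const, Finset.card_univ, Fintype.card_fin, ENNReal.toReal_pow]
  rw [← measureReal_def, probReal_compl_eq_one_sub (hsec _)]

theorem one_sub_one_sub_pow_le (x : ℝ) (hx : x ≤ 1) (d : ℕ) : 1 - (1 - x) ^ d ≤ d * x := by
  have := one_add_mul_le_pow (a := -x) (by linarith) d
  rw [← sub_eq_add_neg] at this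
  linarith

theorem le_one_sub_one_sub_pow {x : ℝ} (h0 : 0 ≤ x) (hx : x ≤ 1) (d : ℕ) :
    d * x - d ^ 2 * x ^ 2 ≤ 1 - (1 - x) ^ d := by
  induction d with
  | zero => simp
  | succ d ih =>
    have h1 := mul_nonneg (sub_nonneg.2 (one_sub_one_sub_pow_le x hx d)) h0
    rw [pow_succ (1 - x) d]
    push_cast
    have h2 : 0 ≤ x ^ 2 := sq_nonneg x
    have h3 : 0 ≤ (d : ℝ) * x ^ 2 := by positivity
    nlinarith

theorem exp_neg_mul_pow_div_factorial_le_one {t : ℝ} (ht : 0 ≤ t) (n : ℕ) :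
    Real.exp (-t) * (t ^ n / n.factorial) ≤ 1 := by
  rw [Real.exp_neg, inv_mul_le_iff₀ (Real.exp_pos t), mul_one]
  exact Real.pow_div_factorial_le_exp t ht n

theorem integral_sub_pow (t : ℝ) (n : ℕ) :
    ∫ r in 0..t, (t - r) ^ n = t ^ (n + 1) / (n + 1) := by
  rw [intervalIntegral.integral_comp_sub_left (fun r => r ^ n) t, sub_self, sub_zero, integral_pow]
  simp

theorem integral_exp_neg_interval (t : ℝ) : ∫ r in 0..t, Real.exp (-r) = 1 - Real.exp (-t) := by
  rw [intervalIntegral.integral_comp_neg, integral_exp]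
  simp

/-- The constant in the quadratic error term of `le_treeMeasure_reach`. -/
def reachError (d : ℕ) : ℕ → ℝ
  | 0 => 0
  | n + 1 => d * reachError d n + d ^ 2 * (d ^ n) ^ 2

theorem reachError_nonneg (d n : ℕ) : 0 ≤ reachError d n := by
  induction n with
  | zero => exact le_rfl
  | succ n ih => rw [reachError]; positivity

/-- The main term bounds from below the expected number of suitable endpoints: `d ^ n` paths, each
cheap with probability at least `exp (-t) * t ^ n / n!`, and an independent chance of at least `p`
at the end. The correction for several successes is quadratic in `p`, with a coefficient free of `t`
and `p`; for small `p` the linear term wins. -/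
theorem le_treeMeasure_reach {A : Set (Vertex d → ℝ)} (hA : MeasurableSet A) {p : ℝ}
    (hp0 : 0 ≤ p) (hp : p ≤ (treeMeasure d).real A) (n : ℕ) {t : ℝ} (ht : 0 ≤ t) :
    d ^ n * p * (Real.exp (-t) * (t ^ n / n.factorial)) - reachError d n * p ^ 2 ≤
      (treeMeasure d).real {u | Reach A n t u} := by
  induction n generalizing t with
  | zero =>
    have : {u | Reach A 0 t u} = A := by
      ext u
      simp [reach_zero, ht]
    rw [this]
    refine le_trans ?_ hp
    have := exp_neg_mul_pow_div_factorial_le_one ht 0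
    simp only [reachError, pow_zero, zero_mul, sub_zero, one_mul] at this ⊢
    exact mul_le_of_le_one_right hp0 this
  | succ n ih =>
    set q : ℝ → ℝ := fun t => (treeMeasure d).real {u | Reach A n t u} with hq
    have hq0 : ∀ t, 0 ≤ q t := fun t => measureReal_nonneg
    have hq1 : ∀ t, q t ≤ 1 := fun t => measureReal_le_one
    have hqm : Measurable q := measurable_treeMeasure_reach hA n
    have hrec : (treeMeasure d).real {u | Reach A (n + 1) t u} =
        ∫ r, (1 - (1 - q (t - r)) ^ d) ∂expMeasure 1 := by
      simp only [reach_succ]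
      exact treeMeasure_eq_integral (measurableSet_reach hA n) t
    set l : ℝ → ℝ := fun s =>
      d ^ n * p * (Real.exp (-s) * (s ^ n / n.factorial)) - reachError d n * p ^ 2 with hl
    have hbound : ∀ r, 0 ≤ r → r ≤ t →
        d * l (t - r) - d ^ 2 * (d ^ n) ^ 2 * p ^ 2 ≤ 1 - (1 - q (t - r)) ^ d := by
      intro r _ hr
      have hs : 0 ≤ t - r := by linarith
      have hlq : l (t - r) ≤ q (t - r) := ih hs
      have hq1' := hq1 (t - r)
      -- Where the inductive lower bound `l` is negative the claim is trivial; otherwise `1 - (1 -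
      -- x) ^ d` is expanded to second order at `x = l (t - r)`.
      rcases le_total (l (t - r)) 0 with hneg | hpos
      · have h1 : (1 - q (t - r)) ^ d ≤ 1 :=
          pow_le_one₀ (by linarith) (by linarith [hq0 (t - r)])
        have h2 : (d : ℝ) * l (t - r) ≤ 0 := mul_nonpos_of_nonneg_of_nonpos d.cast_nonneg hneg
        have h3 : 0 ≤ (d : ℝ) ^ 2 * (d ^ n) ^ 2 * p ^ 2 := by positivity
        linarith
      · have h1 : (1 - q (t - r)) ^ d ≤ (1 - l (t - r)) ^ d :=
          pow_le_pow_left₀ (by linarith) (by linarith) d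
        have h2 := le_one_sub_one_sub_pow hpos (hlq.trans hq1') d
        have h3 : l (t - r) ≤ d ^ n * p := by
          have h4 := mul_le_of_le_one_right (by positivity : 0 ≤ (d : ℝ) ^ n * p)
            (exp_neg_mul_pow_div_factorial_le_one hs n)
          have h5 := mul_nonneg (reachError_nonneg d n) (sq_nonneg p)
          simp only [hl]
          linarith
        have h4 : l (t - r) ^ 2 ≤ (d ^ n * p) ^ 2 := pow_le_pow_left₀ hpos h3 2
        have h5 := mul_le_mul_of_nonneg_left h4 (sq_nonneg (d : ℝ))
        nlinarith
    have key := intervalIntegral_le_integral_expMeasure ht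
      (f := fun r => 1 - (1 - q (t - r)) ^ d)
      (g := fun r => d * l (t - r) - d ^ 2 * (d ^ n) ^ 2 * p ^ 2) (by fun_prop)
      (fun r => sub_nonneg.2 (pow_le_one₀ (by linarith [hq1 (t - r)]) (by linarith [hq0 (t - r)])))
      (fun r => sub_le_self _ (pow_nonneg (by linarith [hq1 (t - r)]) _))
      (by simp only [hl]; fun_prop) hbound
    rw [hrec]
    refine le_trans ?_ key
    have hsplit : ∀ r, Real.exp (-r) * (d * l (t - r) - d ^ 2 * (d ^ n) ^ 2 * p ^ 2) =
        d ^ (n + 1) * p * (Real.exp (-t) / n.factorial) * (t - r) ^ n -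
          reachError d (n + 1) * p ^ 2 * Real.exp (-r) := by
      intro r
      have : Real.exp (-t) = Real.exp (-r) * Real.exp (-(t - r)) := by
        rw [← Real.exp_add]; ring_nf
      simp only [hl, reachError]
      rw [this]
      ring
    simp only [hsplit]
    rw [intervalIntegral.integral_sub (Continuous.intervalIntegrable (by fun_prop) _ _)
      (Continuous.intervalIntegrable (by fun_prop) _ _), intervalIntegral.integral_const_mul,
      intervalIntegral.integral_const_mul, integral_sub_pow, integral_exp_neg_interval]
    have h1 : d ^ (n + 1) * p * (Real.exp (-t) * (t ^ (n + 1) / (n + 1).factorial)) =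
        d ^ (n + 1) * p * (Real.exp (-t) / n.factorial) * (t ^ (n + 1) / (n + 1)) := by
      rw [Nat.factorial_succ]
      push_cast
      field_simp
    -- The error integrates to a factor `1 - exp (-t)`; it is bounded by 1 to keep the constant
    -- independent of `t`.
    have h2 : 0 ≤ reachError d (n + 1) * p ^ 2 * Real.exp (-t) :=
      mul_nonneg (mul_nonneg (reachError_nonneg d _) (sq_nonneg p)) (Real.exp_pos _).le
    linarith

/-- The labellings for which there is a path made of `k` blocks of `m` vertices, each with total
label at most `t`. -/
def blockPath (m : ℕ) (t : ℝ) : ℕ → Set (Vertex d → ℝ)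
  | 0 => Set.univ
  | k + 1 => {u | Reach (blockPath m t k) m t u}

theorem measurableSet_blockPath (m : ℕ) (t : ℝ) (k : ℕ) :
    MeasurableSet (blockPath (d := d) m t k) := by
  induction k with
  | zero => exact MeasurableSet.univ
  | succ k ih => exact measurableSet_reach_right ih m t

theorem antitone_blockPath (m : ℕ) (t : ℝ) : Antitone (blockPath (d := d) m t) := by
  refine antitone_nat_of_succ_le fun k => ?_
  induction k with
  | zero => exact Set.subset_univ _
  | succ k ih =>
    rintro u ⟨x, hx, h, hA⟩
    exact ⟨x, hx, h, ih hA⟩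

/-- Survival of a supercritical process. With mean bound `ρ > 1` and error constant `E`, one more
block preserves the bound `δ` as soon as `ρ * δ - E * δ ^ 2 ≥ δ`, that is `E * δ ≤ ρ - 1`. -/
theorem exists_pos_le_blockPath {m : ℕ} {t : ℝ} (ht : 0 ≤ t)
    (h : 1 < (d : ℝ) ^ m * (Real.exp (-t) * (t ^ m / m.factorial))) :
    ∃ δ > 0, ∀ k, δ ≤ (treeMeasure d).real (blockPath m t k) := by
  set ρ := (d : ℝ) ^ m * (Real.exp (-t) * (t ^ m / m.factorial)) with hρ
  have hE := reachError_nonneg d m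
  set E := reachError d m with hE'
  have hpos : 0 < (ρ - 1) / (E + 1) := div_pos (by linarith) (by linarith)
  refine ⟨min 1 ((ρ - 1) / (E + 1)), lt_min one_pos hpos, fun k => ?_⟩
  set δ := min 1 ((ρ - 1) / (E + 1)) with hδ
  have hδ0 : 0 ≤ δ := (lt_min one_pos hpos).le
  induction k with
  | zero => simp [blockPath, hδ]
  | succ k ih =>
    have h1 := le_treeMeasure_reach (measurableSet_blockPath m t k) hδ0 ih m ht
    refine le_trans ?_ h1
    have h2 : δ * (E + 1) ≤ ρ - 1 := (le_div_iff₀ (by linarith)).1 (min_le_right _ _)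
    have h3 : d ^ m * δ * (Real.exp (-t) * (t ^ m / m.factorial)) = ρ * δ := by rw [hρ]; ring
    rw [h3]
    nlinarith

theorem le_iInter_blockPath {m : ℕ} {t δ : ℝ}
    (h : ∀ k, δ ≤ (treeMeasure d).real (blockPath m t k)) :
    δ ≤ (treeMeasure d).real (⋂ k, blockPath m t k) := by
  have h1 := tendsto_measure_iInter_atTop (μ := treeMeasure d)
    (fun k => (measurableSet_blockPath m t k).nullMeasurableSet) (antitone_blockPath m t)
    ⟨0, measure_ne_top _ _⟩
  exact ge_of_tendsto' ((ENNReal.tendsto_toReal (measure_ne_top _ _)).comp h1) h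

/-! ### From positive probability to almost sure slow paths -/

/-- A property of positive probability almost surely holds in the subtree of some vertex. -/
theorem ae_exists_shift_mem (hd : 2 ≤ d) {A : Set (Vertex d → ℝ)} (hA : MeasurableSet A)
    (hpos : 0 < (treeMeasure d).real A) : ∀ᵐ u ∂treeMeasure d, ∃ y, shift y u ∈ A := by
  set D : Set (Vertex d → ℝ) := {u | ∃ y, shift y u ∈ A} with hD
  have hDm : MeasurableSet D := by
    rw [hD, Set.ofPred_exists]
    exact MeasurableSet.iUnion fun y => measurable_shift y hA
  -- If `D` holds in a child's subtree it holds at the root. The first coordinate is a dummy. The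
  -- probability `x` of failure thus satisfies `x ≤ x ^ d ≤ x ^ 2` with `x < 1`, so `x = 0`.
  have hsub : {u : Vertex d → ℝ | ∃ i, (0 - u [], shift [i] u) ∈ Set.univ ×ˢ D} ⊆ D := by
    rintro u ⟨i, -, y, hy⟩
    exact ⟨i :: y, hy⟩
  have h1 := measureReal_mono (μ := treeMeasure d) hsub
  rw [treeMeasure_eq_integral (MeasurableSet.univ.prod hDm)] at h1
  simp only [Set.mem_prod, Set.mem_univ, true_and, Set.ofPred_mem_eq, integral_const,
    probReal_univ, one_smul] at h1
  have hD0 : 0 < (treeMeasure d).real D :=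
    hpos.trans_le (measureReal_mono fun u hu => ⟨[], hu⟩)
  have hD1 : (treeMeasure d).real D ≤ 1 := measureReal_le_one
  set x := 1 - (treeMeasure d).real D with hx
  have hx0 : 0 ≤ x := by linarith
  have h2 : x ≤ x ^ 2 := by
    have : x ^ d ≤ x ^ 2 := pow_le_pow_of_le_one hx0 (by linarith) hd
    linarith
  have h3 : x = 0 := by
    by_contra hne
    have : 0 < x := lt_of_le_of_ne hx0 (Ne.symm hne)
    nlinarith
  have h4 : (treeMeasure d).real Dᶜ = 0 := by rw [probReal_compl_eq_one_sub hDm]; exact h3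
  exact (measureReal_eq_zero_iff).1 h4

/-- Complete blocks respect the slope `b`; by nonnegativity, an unfinished block costs at most its
full budget `b * m`. -/
theorem exists_path_of_mem_blockPath {u : Vertex d → ℝ} (hu : ∀ x, 0 ≤ u x) {m : ℕ} {b : ℝ}
    (hb : 0 ≤ b) {k : ℕ} (h : u ∈ blockPath m (b * m) k) :
    ∃ x : Vertex d, x.length = k * m ∧ ∀ n ≤ k * m, pathSum u x n ≤ b * m + b * n := by
  induction k generalizing u with
  | zero =>
    refine ⟨[], by simp, fun n hn => ?_⟩
    obtain rfl : n = 0 := by simpa using hn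
    simp only [pathSum, Finset.range_zero, Finset.sum_empty]
    positivity
  | succ k ih =>
    obtain ⟨x, hx, hsum, hA⟩ := h
    obtain ⟨z, hz, hzs⟩ := ih (fun y => hu _) hA
    refine ⟨x ++ z, by rw [List.length_append, hx, hz]; ring, fun n hn => ?_⟩
    rcases le_total n m with hnm | hnm
    · rw [pathSum_append_of_le u x z (hnm.trans hx.ge)]
      have := (pathSum_mono hu x hnm).trans hsum
      have h2 : 0 ≤ b * n := by positivity
      linarith
    · obtain ⟨j, rfl⟩ := Nat.exists_eq_add_of_le hnm
      have hj : j ≤ k * m := by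
        have : (k + 1) * m = k * m + m := by ring
        omega
      have := pathSum_append_add u x z j
      rw [hx] at this
      rw [this]
      push_cast
      have h1 : pathSum (shift x u) z j ≤ b * m + b * j := hzs j hj
      linarith

/-- There are paths of every length whose partial sums grow at rate at most `b`. -/
def HasSlowPaths (u : Vertex d → ℝ) (K b : ℝ) : Prop :=
  ∀ N : ℕ, ∃ x : Vertex d, x.length = N ∧ ∀ n ≤ N + 1, pathSum u x n ≤ K + b * n

theorem hasSlowPaths_of_shift_mem {u : Vertex d → ℝ} (hu : ∀ x, 0 ≤ u x) {m : ℕ} (hm : 0 < m)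
    {b : ℝ} (hb : 0 ≤ b) {y : Vertex d} (h : shift y u ∈ ⋂ k, blockPath m (b * m) k) :
    HasSlowPaths u (pathSum u y y.length + b * m) b := by
  intro N
  obtain ⟨z, hz, hzs⟩ := exists_path_of_mem_blockPath (fun x => hu _) hb
    (Set.mem_iInter.1 h (N + 1))
  have hNm : N + 1 ≤ (N + 1) * m := Nat.le_mul_of_pos_right _ hm
  have hlen : N + 1 ≤ (y ++ z).length := by rw [List.length_append, hz]; omega
  refine ⟨(y ++ z).take N, by rw [List.length_take]; omega, fun n hn => ?_⟩
  rw [pathSum_take u _ hn]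
  have hbn : 0 ≤ b * n := by positivity
  have hbm : 0 ≤ b * m := by positivity
  rcases le_total n y.length with hny | hny
  · rw [pathSum_append_of_le u y z hny]
    linarith [pathSum_mono hu y hny]
  · obtain ⟨j, rfl⟩ := Nat.exists_eq_add_of_le hny
    rw [pathSum_append_add]
    have h1 : pathSum (shift y u) z j ≤ b * m + b * j := hzs j (by omega)
    have h2 : 0 ≤ b * y.length := by positivity
    push_cast
    linarith

/-! ### The speed equation and the choice of block length -/

theorem strictMonoOn_mul_exp_one_sub :
    StrictMonoOn (fun c : ℝ => c * Real.exp (1 - c)) (Set.Icc 0 1) := by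
  refine strictMonoOn_of_deriv_pos (convex_Icc 0 1) (by fun_prop) fun x hx => ?_
  rw [interior_Icc] at hx
  have h : HasDerivAt (fun c : ℝ => c * Real.exp (1 - c))
      (1 * Real.exp (1 - x) + x * (Real.exp (1 - x) * -1)) x :=
    (hasDerivAt_id x).mul ((hasDerivAt_id x).const_sub 1).exp
  rw [h.deriv]
  have := mul_pos (sub_pos.2 hx.2) (Real.exp_pos (1 - x))
  linarith

theorem exists_isSpeedRoot (hd : 2 ≤ d) : ∃ c, IsSpeedRoot d c := by
  have hd' : (2 : ℝ) ≤ d := by exact_mod_cast hd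
  have hcont : ContinuousOn (fun c : ℝ => (d : ℝ) * c * Real.exp (1 - c)) (Set.Icc 0 1) := by
    fun_prop
  obtain ⟨c, hc, h⟩ := intermediate_value_Ioo zero_le_one hcont
    (show (1 : ℝ) ∈ Set.Ioo _ _ by
      simp only [mul_zero, zero_mul, mul_one, sub_self, Real.exp_zero]
      exact ⟨one_pos, by linarith⟩)
  exact ⟨c, hc.1, hc.2, h⟩

theorem mul_mul_exp_one_sub_lt {a b : ℝ} (hd : 2 ≤ d) (ha : 0 ≤ a) (hab : a < b) (hb : b ≤ 1) :
    (d : ℝ) * a * Real.exp (1 - a) < d * b * Real.exp (1 - b) := by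
  have := strictMonoOn_mul_exp_one_sub ⟨ha, hab.le.trans hb⟩ ⟨ha.trans hab.le, hb⟩ hab
  have hd' : (0 : ℝ) < d := by exact_mod_cast (by omega : 0 < d)
  simpa [mul_assoc] using mul_lt_mul_of_pos_left this hd'

/-- The Stirling sequence is decreasing, so it is bounded by its first value `exp 1 / √2`; then `√n
≤ n` for `n ≥ 1`. -/
theorem factorial_le (n : ℕ) :
    ((n + 1).factorial : ℝ) ≤ Real.exp 1 * (n + 1 : ℕ) * ((n + 1 : ℕ) / Real.exp 1) ^ (n + 1) := by
  have h1 := Stirling.stirlingSeq'_antitone (Nat.zero_le n)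
  simp only [Function.comp, Nat.succ_eq_add_one, zero_add, Stirling.stirlingSeq_one] at h1
  rw [Stirling.stirlingSeq, div_le_iff₀ (by positivity)] at h1
  refine h1.trans ?_
  rw [← mul_assoc]
  refine mul_le_mul_of_nonneg_right ?_ (by positivity)
  rw [Real.sqrt_mul (by norm_num), div_mul_eq_mul_div, mul_comm √2, ← mul_assoc,
    mul_div_cancel_right₀ _ (by positivity)]
  refine mul_le_mul_of_nonneg_left ?_ (Real.exp_pos 1).le
  rw [Real.sqrt_le_left (by positivity)]
  have : (1 : ℝ) ≤ (n + 1 : ℕ) := by simp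
  nlinarith

/-- By Stirling the mean bound is at least `x ^ m / (exp 1 * m)` with `x = d * b * exp (1 - b) > 1`,
and the exponential wins. -/
theorem exists_block_length {b : ℝ} (hb : 0 < b) (h : 1 < (d : ℝ) * b * Real.exp (1 - b)) :
    ∃ m : ℕ, 0 < m ∧
      1 < (d : ℝ) ^ m * (Real.exp (-(b * m)) * ((b * m) ^ m / m.factorial)) := by
  set x := (d : ℝ) * b * Real.exp (1 - b) with hx
  have hlim : Tendsto (fun n : ℕ => (n : ℝ) / x ^ n) atTop (𝓝 0) := by
    simpa using tendsto_pow_const_div_const_pow_of_one_lt 1 h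
  have hev := hlim.eventually_lt_const (inv_pos.2 (Real.exp_pos 1))
  obtain ⟨m, hm, hm0⟩ := (hev.and (eventually_gt_atTop 0)).exists
  refine ⟨m, hm0, ?_⟩
  obtain ⟨n, rfl⟩ : ∃ n, m = n + 1 := ⟨m - 1, by omega⟩
  have hxp : 0 < x ^ (n + 1) := pow_pos (by linarith) _
  rw [div_lt_iff₀ hxp, inv_mul_eq_div, lt_div_iff₀ (Real.exp_pos 1)] at hm
  have hf := factorial_le n
  have hfp : (0 : ℝ) < (n + 1).factorial := by exact_mod_cast Nat.factorial_pos _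
  have hm' : (0 : ℝ) < (n + 1 : ℕ) := by positivity
  rw [mul_div_assoc', mul_div_assoc', one_lt_div hfp]
  refine hf.trans_lt ?_
  have key : (d : ℝ) ^ (n + 1) * (Real.exp (-(b * (n + 1 : ℕ))) * (b * (n + 1 : ℕ)) ^ (n + 1)) =
      x ^ (n + 1) * ((n + 1 : ℕ) / Real.exp 1) ^ (n + 1) := by
    have h1 : Real.exp (-(b * (n + 1 : ℕ))) = Real.exp (-b) ^ (n + 1) := by
      rw [← Real.exp_nat_mul]; ring_nf
    rw [h1, ← mul_pow, ← mul_pow, ← mul_pow, hx, Real.exp_sub, Real.exp_neg]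
    congr 1
    field_simp
  rw [key]
  refine mul_lt_mul_of_pos_right ?_ (by positivity)
  linarith

theorem ae_exists_hasSlowPaths (hd : 2 ≤ d) {b : ℝ} (hb : 0 < b)
    (h : 1 < (d : ℝ) * b * Real.exp (1 - b)) :
    ∀ᵐ u ∂treeMeasure d, ∃ K, HasSlowPaths u K b := by
  obtain ⟨m, hm, hm1⟩ := exists_block_length hb h
  obtain ⟨δ, hδ, hk⟩ := exists_pos_le_blockPath (by positivity : 0 ≤ b * m) hm1
  filter_upwards [ae_nonneg_treeMeasure, ae_exists_shift_mem hd
    (MeasurableSet.iInter fun k => measurableSet_blockPath m (b * m) k)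
    (hδ.trans_le (le_iInter_blockPath hk))] with u hu ⟨y, hy⟩
  exact ⟨_, hasSlowPaths_of_shift_mem hu hm hb.le hy⟩

/-! ### The lower bound on all path sums -/

theorem treeMeasure_pathSum_le {a : ℝ} (ha : 0 < a) (ha1 : a < 1) (x : Vertex d) :
    (treeMeasure d).real {u | pathSum u x (x.length + 1) ≤ a * (x.length + 1 : ℕ)} ≤
      (a * Real.exp (1 - a)) ^ (x.length + 1) := by
  have ha' : 1 < a⁻¹ := (one_lt_inv₀ ha).2 ha1
  -- The exponent `1 - a⁻¹ < 0` is the optimal one in Chernoff's bound.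
  refine (measure_le_le_exp_mul_mgf (t := 1 - a⁻¹) _ (by linarith)
    (integrable_exp_mul_pathSum (by linarith) le_rfl)).trans_eq ?_
  rw [mgf_pathSum (by linarith) le_rfl, sub_sub_cancel, inv_inv, mul_pow, mul_comm]
  congr 1
  rw [← Real.exp_nat_mul]
  congr 1
  field_simp
  ring

theorem treeMeasure_exists_pathSum_le {a : ℝ} (hd : 2 ≤ d) (ha : 0 < a) (ha1 : a < 1) (n : ℕ) :
    treeMeasure d {u | ∃ x : Vertex d, x.length = n ∧ pathSum u x (n + 1) ≤ a * (n + 1 : ℕ)} ≤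
      ENNReal.ofReal ((d * a * Real.exp (1 - a)) ^ (n + 1)) := by
  have hsub : {u | ∃ x : Vertex d, x.length = n ∧ pathSum u x (n + 1) ≤ a * (n + 1 : ℕ)} ⊆
      ⋃ f : Fin n → Fin d, {u | pathSum u (List.ofFn f) ((List.ofFn f).length + 1) ≤
        a * ((List.ofFn f).length + 1 : ℕ)} := by
    rintro u ⟨x, rfl, hx⟩
    refine Set.mem_iUnion.2 ⟨x.get, ?_⟩
    simpa using hx
  refine (measure_mono hsub).trans ((measure_iUnion_le _).trans ?_)
  rw [tsum_fintype]
  calc _ ≤ ∑ _f : Fin n → Fin d, ENNReal.ofReal ((a * Real.exp (1 - a)) ^ (n + 1)) := by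
        refine Finset.sum_le_sum fun f _ => ?_
        have := treeMeasure_pathSum_le ha ha1 (List.ofFn f)
        rw [← ofReal_measureReal]
        refine ENNReal.ofReal_le_ofReal (this.trans_eq ?_)
        rw [List.length_ofFn]
    _ = ENNReal.ofReal (d ^ n * (a * Real.exp (1 - a)) ^ (n + 1)) := by
        rw [Finset.sum_const, nsmul_eq_mul, ENNReal.ofReal_mul (by positivity)]
        simp
    _ ≤ _ := by
        refine ENNReal.ofReal_le_ofReal ?_
        rw [mul_assoc, mul_pow (d : ℝ)]
        refine mul_le_mul_of_nonneg_right ?_ (by positivity)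
        refine pow_le_pow_right₀ ?_ (Nat.le_succ n)
        exact_mod_cast (by omega : 1 ≤ d)

theorem ae_exists_le_pathSum (hd : 2 ≤ d) {a : ℝ} (ha : 0 < a) (ha1 : a < 1)
    (h : (d : ℝ) * a * Real.exp (1 - a) < 1) :
    ∀ᵐ u ∂treeMeasure d, ∃ K, ∀ (x : Vertex d) (n : ℕ), n ≤ x.length + 1 →
      a * n - K ≤ pathSum u x n := by
  have hx0 : 0 ≤ (d : ℝ) * a * Real.exp (1 - a) := by positivity
  have hsum : ∑' n, treeMeasure d {u | ∃ x : Vertex d, x.length = n ∧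
      pathSum u x (n + 1) ≤ a * (n + 1 : ℕ)} ≠ ∞ := by
    refine ne_top_of_le_ne_top ?_
      (ENNReal.tsum_le_tsum fun n => treeMeasure_exists_pathSum_le hd ha ha1 n)
    exact ((summable_nat_add_iff 1).2 (summable_geometric_of_lt_one hx0 h)).tsum_ofReal_ne_top
  filter_upwards [ae_nonneg_treeMeasure, ae_eventually_notMem hsum] with u hu hev
  obtain ⟨N, hN⟩ := eventually_atTop.1 hev
  have hNa : 0 ≤ a * (N + 1) := by positivity
  -- This constant makes the bound trivial for the early sums, which are nonnegative.
  refine ⟨a * (N + 1), fun x n hn => ?_⟩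
  rcases n with _ | j
  · simp only [pathSum, Finset.range_zero, Finset.sum_empty, Nat.cast_zero, mul_zero, zero_sub]
    linarith
  · rcases le_total N j with hNj | hNj
    · have h1 := hN j hNj
      simp only [not_exists, not_and, not_le] at h1
      have h2 := h1 (x.take j) (by rw [List.length_take]; omega)
      rw [pathSum_take u x le_rfl] at h2
      linarith
    · have h1 : a * (j + 1 : ℕ) ≤ a * (N + 1) := by
        push_cast
        gcongr
      linarith [pathSum_nonneg hu x (j + 1)]

/-! ### An integrable dominating variable -/

/-- Along one fixed ray with sums `S n`, the excess `S n - 2 * n` is at most `2 * exp (S n / 2 -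
n)`. The sum of these over `n ≥ 1` serves as `K`; its mean is `2 * ∑ (2 / e) ^ n`, finite since `2 <
e`. The slope 2 is far from optimal but enough for domination. -/
theorem exists_integrable_hasSlowPaths (hd : 2 ≤ d) :
    ∃ K : (Vertex d → ℝ) → ℝ, Integrable K (treeMeasure d) ∧ (∀ u, 0 ≤ K u) ∧
      ∀ᵐ u ∂treeMeasure d, HasSlowPaths u (K u) 2 := by
  let x : ℕ → Vertex d := fun n => List.replicate n ⟨0, by omega⟩
  have hxl : ∀ n, (x n).length = n := fun n => List.length_replicate
  have hxt : ∀ {j N : ℕ}, j ≤ N → (x N).take j = x j := fun {j N} h => by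
    simp only [x, List.take_replicate, min_eq_left h]
  let f : ℕ → (Vertex d → ℝ) → ℝ := fun n u =>
    2 * (Real.exp (-(n + 1 : ℕ)) * Real.exp (1 / 2 * pathSum u (x n) (n + 1)))
  have hfm : ∀ n, Measurable (f n) := fun n => by
    have := measurable_pathSum (x n) (n + 1)
    fun_prop
  have hf0 : ∀ n u, 0 ≤ f n u := fun n u => by positivity
  have hfi : ∀ n, ∫⁻ u, ENNReal.ofReal (f n u) ∂treeMeasure d =
      ENNReal.ofReal (2 * (2 / Real.exp 1) ^ (n + 1)) := by
    intro n
    have hint := integrable_exp_mul_pathSum (s := 1 / 2) (by norm_num) (x := x n) (n := n + 1)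
      (by rw [hxl])
    rw [← ofReal_integral_eq_lintegral_ofReal ((hint.const_mul _).const_mul _)
      (ae_of_all _ (hf0 n)), integral_const_mul, integral_const_mul]
    have hm := mgf_pathSum (s := 1 / 2) (by norm_num) (x := x n) (n := n + 1) (by rw [hxl])
    rw [mgf] at hm
    rw [hm, Real.exp_neg, ← Real.exp_one_pow, ← inv_pow, ← mul_pow]
    norm_num
    ring_nf
  let Z : (Vertex d → ℝ) → ℝ≥0∞ := fun u => ∑' n, ENNReal.ofReal (f n u)
  have hZm : Measurable Z := Measurable.tsum fun n => (hfm n).ennreal_ofReal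
  have hZ : ∫⁻ u, Z u ∂treeMeasure d ≠ ∞ := by
    rw [lintegral_tsum fun n => (hfm n).ennreal_ofReal.aemeasurable]
    simp only [hfi]
    have hlt : 2 / Real.exp 1 < 1 := by
      rw [div_lt_one (Real.exp_pos 1)]
      linarith [Real.exp_one_gt_d9]
    exact (((summable_nat_add_iff 1).2 (summable_geometric_of_lt_one (by positivity)
      hlt)).mul_left 2).tsum_ofReal_ne_top
  refine ⟨fun u => (Z u).toReal, integrable_toReal_of_lintegral_ne_top hZm.aemeasurable hZ,
    fun u => ENNReal.toReal_nonneg, ?_⟩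
  filter_upwards [ae_lt_top hZm hZ] with u hu N
  refine ⟨x N, hxl N, fun n hn => ?_⟩
  rcases n with _ | j
  · simp [pathSum]
  · have h1 : pathSum u (x N) (j + 1) = pathSum u (x j) (j + 1) := by
      rw [← hxt (by omega : j ≤ N), pathSum_take u _ le_rfl]
    have h2 : f j u ≤ (Z u).toReal := by
      rw [← ENNReal.ofReal_le_iff_le_toReal hu.ne]
      exact ENNReal.le_tsum j
    have h3 : f j u = 2 * Real.exp (1 / 2 * pathSum u (x j) (j + 1) - (j + 1 : ℕ)) := by
      simp only [f]
      rw [← Real.exp_add]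
      ring_nf
    have h4 := Real.add_one_le_exp (1 / 2 * pathSum u (x j) (j + 1) - (j + 1 : ℕ))
    rw [h1]
    linarith

/-! ### Convergence almost surely and in mean -/

theorem HasSlowPaths.timeToInfinity_le {u : Vertex d → ℝ} {K b α : ℝ} (h : HasSlowPaths u K b)
    (hK : 0 ≤ K) (hb : 0 ≤ b) (h0 : 0 ≤ α) (h1 : α < 1) :
    timeToInfinity u α ≤ ENNReal.ofReal (K + b / (1 - α)) := by
  refine TreePercolation.timeToInfinity_le (fun N => ?_)
    (add_nonneg hK (div_nonneg hb (by linarith)))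
  obtain ⟨x, rfl, hxs⟩ := h N
  exact ⟨x, rfl, passageTime_le h0 h1 hb hxs⟩

theorem HasSlowPaths.mono {u : Vertex d → ℝ} {K K' b : ℝ} (h : HasSlowPaths u K b)
    (hK : K ≤ K') : HasSlowPaths u K' b := fun N => by
  obtain ⟨x, hx, hxs⟩ := h N
  exact ⟨x, hx, fun n hn => (hxs n hn).trans (by linarith)⟩

theorem HasSlowPaths.scaled_timeToInfinity_le {u : Vertex d → ℝ} {K b α : ℝ}
    (h : HasSlowPaths u K b) (hK : 0 ≤ K) (hb : 0 ≤ b) (h0 : 0 ≤ α) (h1 : α < 1) :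
    (1 - α) * (timeToInfinity u α).toReal ≤ b + (1 - α) * K := by
  have h2 := ENNReal.toReal_le_of_le_ofReal
    (add_nonneg hK (div_nonneg hb (by linarith))) (h.timeToInfinity_le hK hb h0 h1)
  have h3 : 0 < 1 - α := by linarith
  calc (1 - α) * (timeToInfinity u α).toReal ≤ (1 - α) * (K + b / (1 - α)) :=
        mul_le_mul_of_nonneg_left h2 h3.le
    _ = _ := by field_simp; ring

theorem le_scaled_timeToInfinity {u : Vertex d → ℝ} {K a α : ℝ} (ha : 0 ≤ a)
    (h : ∀ (x : Vertex d) (n : ℕ), n ≤ x.length + 1 → a * n - K ≤ pathSum u x n)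
    (h0 : 0 ≤ α) (h1 : α < 1) (hfin : timeToInfinity u α < ∞) :
    a - (1 - α) * K ≤ (1 - α) * (timeToInfinity u α).toReal := by
  have h2 := le_timeToInfinity h0 h1 ha fun x => le_passageTime (K := K) h0 h1 (h x)
  rw [ENNReal.ofReal_le_iff_le_toReal hfin.ne] at h2
  have h3 : 0 < 1 - α := by linarith
  calc a - (1 - α) * K = (1 - α) * (a / (1 - α) - K) := by field_simp
    _ ≤ _ := mul_le_mul_of_nonneg_left h2 h3.le

theorem eventually_mem_Ioo_nhdsLT_one : ∀ᶠ α in 𝓝[<] (1 : ℝ), α ∈ Set.Ioo (0 : ℝ) 1 :=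
  Ioo_mem_nhdsLT one_pos

theorem tendsto_add_one_sub_mul (b K : ℝ) :
    Tendsto (fun α : ℝ => b + (1 - α) * K) (𝓝[<] 1) (𝓝 b) := by
  have : Tendsto (fun α : ℝ => b + (1 - α) * K) (𝓝 1) (𝓝 (b + (1 - 1) * K)) :=
    Continuous.tendsto (by fun_prop) 1
  rw [sub_self, zero_mul, add_zero] at this
  exact this.mono_left nhdsWithin_le_nhds

theorem ae_finite_and_tendsto (hd : 2 ≤ d) {c : ℝ} (hc : IsSpeedRoot d c) :
    ∀ᵐ u ∂treeMeasure d, (∀ α ∈ Set.Ioo (0 : ℝ) 1, timeToInfinity u α < ∞) ∧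
      Tendsto (fun α : ℝ => (1 - α) * (timeToInfinity u α).toReal) (𝓝[<] 1) (𝓝 c) := by
  obtain ⟨hc0, hc1, hce⟩ := hc
  -- Rational slopes keep the exceptional set a countable union of null sets.
  have hup : ∀ᵐ u ∂treeMeasure d, ∀ b : ℚ, c < b → (b : ℝ) < 1 → ∃ K, HasSlowPaths u K b := by
    refine ae_all_iff.2 fun b => ?_
    by_cases hb : c < b ∧ (b : ℝ) < 1
    · filter_upwards [ae_exists_hasSlowPaths hd (hc0.trans hb.1)
        (hce.symm.trans_lt (mul_mul_exp_one_sub_lt hd hc0.le hb.1 hb.2.le))] with u hu _ _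
      exact hu
    · exact ae_of_all _ fun u h1 h2 => absurd ⟨h1, h2⟩ hb
  have hlow : ∀ᵐ u ∂treeMeasure d, ∀ a : ℚ, (0 : ℝ) < a → (a : ℝ) < c → ∃ K : ℝ,
      ∀ (x : Vertex d) (n : ℕ), n ≤ x.length + 1 → (a : ℝ) * n - K ≤ pathSum u x n := by
    refine ae_all_iff.2 fun a => ?_
    by_cases ha : (0 : ℝ) < a ∧ (a : ℝ) < c
    · filter_upwards [ae_exists_le_pathSum hd ha.1 (ha.2.trans hc1)
        ((mul_mul_exp_one_sub_lt hd ha.1.le ha.2 hc1.le).trans_eq hce)] with u hu _ _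
      exact hu
    · exact ae_of_all _ fun u h1 h2 => absurd ⟨h1, h2⟩ ha
  filter_upwards [hup, hlow] with u hu hl
  have hfin : ∀ α ∈ Set.Ioo (0 : ℝ) 1, timeToInfinity u α < ∞ := by
    intro α hα
    obtain ⟨b, hb, hb1⟩ := exists_rat_btwn hc1
    obtain ⟨K, hK⟩ := hu b hb hb1
    exact ((hK.mono (le_max_left K 0)).timeToInfinity_le (le_max_right K 0) (hc0.trans hb).le
      hα.1.le hα.2).trans_lt ENNReal.ofReal_lt_top
  refine ⟨hfin, tendsto_order.2 ⟨fun l hlc => ?_, fun r hcr => ?_⟩⟩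
  · obtain ⟨a, ha, hac⟩ := exists_rat_btwn (max_lt hlc hc0)
    have ha0 : (0 : ℝ) < a := (le_max_right _ _).trans_lt ha
    obtain ⟨K, hK⟩ := hl a ha0 hac
    filter_upwards [eventually_mem_Ioo_nhdsLT_one,
      (tendsto_add_one_sub_mul a (-K)).eventually_const_lt ((le_max_left l 0).trans_lt ha)] with α hα hαl
    have := le_scaled_timeToInfinity ha0.le hK hα.1.le hα.2 (hfin α hα)
    linarith
  · obtain ⟨b, hb, hbr⟩ := exists_rat_btwn (lt_min hcr hc1)
    have hb1 : (b : ℝ) < 1 := hbr.trans_le (min_le_right _ _)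
    obtain ⟨K, hK⟩ := hu b hb hb1
    filter_upwards [eventually_mem_Ioo_nhdsLT_one,
      (tendsto_add_one_sub_mul b (max K 0)).eventually_lt_const
      (hbr.trans_le (min_le_left _ _))] with α hα hαl
    exact ((hK.mono (le_max_left K 0)).scaled_timeToInfinity_le (le_max_right K 0)
      (hc0.trans hb).le hα.1.le hα.2).trans_lt hαl

theorem integrable_timeToInfinity (hd : 2 ≤ d) {α : ℝ} (hα : α ∈ Set.Ioo (0 : ℝ) 1) :
    Integrable (fun u => (timeToInfinity u α).toReal) (treeMeasure d) := by
  obtain ⟨K, hKi, hK0, hK⟩ := exists_integrable_hasSlowPaths hd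
  refine Integrable.mono' (hKi.add (integrable_const (2 / (1 - α))))
    (measurable_timeToInfinity α).ennreal_toReal.aestronglyMeasurable ?_
  filter_upwards [hK] with u hu
  rw [Real.norm_of_nonneg ENNReal.toReal_nonneg]
  exact ENNReal.toReal_le_of_le_ofReal
    (add_nonneg (hK0 u) (div_nonneg zero_le_two (by linarith [hα.2])))
    (hu.timeToInfinity_le (hK0 u) zero_le_two hα.1.le hα.2)

theorem tendsto_eLpNorm_scaled_timeToInfinity (hd : 2 ≤ d) {c : ℝ} (hc : IsSpeedRoot d c) :
    Tendsto (fun α : ℝ => eLpNorm (fun u => (1 - α) * (timeToInfinity u α).toReal - c) 1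
      (treeMeasure d)) (𝓝[<] 1) (𝓝 0) := by
  obtain ⟨K, hKi, hK0, hK⟩ := exists_integrable_hasSlowPaths hd
  simp only [eLpNorm_one_eq_lintegral_enorm]
  have hlim := tendsto_lintegral_filter_of_dominated_convergence (μ := treeMeasure d)
    (l := 𝓝[<] (1 : ℝ)) (f := fun _ => (0 : ℝ≥0∞))
    (F := fun α u => ‖(1 - α) * (timeToInfinity u α).toReal - c‖ₑ)
    -- The rescaled time lies between 0 and `2 + (1 - α) * K u`, so this dominates its distance to
    -- `c` for all `α` in `(0, 1)`.
    (fun u => ENNReal.ofReal (2 + K u + c)) ?_ ?_ ?_ ?_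
  · simpa using hlim
  · exact Eventually.of_forall fun α =>
      (((measurable_timeToInfinity α).ennreal_toReal.const_mul _).sub_const c).enorm
  · filter_upwards [eventually_mem_Ioo_nhdsLT_one] with α hα
    filter_upwards [hK] with u hu
    rw [← ofReal_norm, Real.norm_eq_abs]
    refine ENNReal.ofReal_le_ofReal (abs_le.2 ?_)
    have h1 := hu.scaled_timeToInfinity_le (hK0 u) zero_le_two hα.1.le hα.2
    have h2 : 0 ≤ (1 - α) * (timeToInfinity u α).toReal :=
      mul_nonneg (by linarith [hα.2]) ENNReal.toReal_nonneg
    have h3 : (1 - α) * K u ≤ K u :=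
      mul_le_of_le_one_left (hK0 u) (by linarith [hα.1])
    have := hc.1
    have := hK0 u
    constructor <;> linarith
  · exact (((integrable_const 2).add hKi).add (integrable_const c)).lintegral_lt_top.ne
  · filter_upwards [ae_finite_and_tendsto hd hc] with u hu
    have := (hu.2.sub_const c).enorm
    simpa using this

theorem IsSpeedRoot.eq {c c' : ℝ} (hd : 2 ≤ d) (hc : IsSpeedRoot d c) (hc' : IsSpeedRoot d c') :
    c' = c := by
  obtain ⟨h0, h1, h⟩ := hc
  obtain ⟨h0', h1', h'⟩ := hc'
  rcases lt_trichotomy c' c with hlt | heq | hgt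
  · exact absurd (h'.trans h.symm) (mul_mul_exp_one_sub_lt hd h0'.le hlt h1.le).ne
  · exact heq
  · exact absurd (h.trans h'.symm) (mul_mul_exp_one_sub_lt hd h0.le hgt h1'.le).ne

end TreePercolation

end

theorem theorem8p2 {Ω : Type*} [MeasurableSpace Ω] (P : Measure Ω) [IsProbabilityMeasure P]
    (d : ℕ) (hd : 2 ≤ d) (U : TreePercolation.Vertex d → Ω → ℝ)
    (hU_meas : ∀ x, Measurable (U x))
    (hU_indep : iIndepFun U P)
    (hU_law : ∀ x, P.map (U x) = expMeasure 1) :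
    ∃ c : ℝ, TreePercolation.IsSpeedRoot d c ∧ (∀ c' : ℝ, TreePercolation.IsSpeedRoot d c' → c' = c) ∧
      -- almost surely, all the times are finite, and the rescaled times converge
      (∀ᵐ ω ∂P,
        (∀ α ∈ Set.Ioo (0 : ℝ) 1, TreePercolation.timeToInfinity (fun x => U x ω) α < ∞) ∧
        Tendsto (fun α : ℝ => (1 - α) * (TreePercolation.timeToInfinity (fun x => U x ω) α).toReal)
          (𝓝[<] 1) (𝓝 c)) ∧
      -- the times are integrable, and the rescaled times converge in `L¹`
      (∀ α ∈ Set.Ioo (0 : ℝ) 1,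
        Integrable (fun ω => (TreePercolation.timeToInfinity (fun x => U x ω) α).toReal) P) ∧
      Tendsto (fun α : ℝ =>
          eLpNorm (fun ω => (1 - α) * (TreePercolation.timeToInfinity (fun x => U x ω) α).toReal - c) 1 P)
        (𝓝[<] 1) (𝓝 0) := by
  have hmeas : Measurable fun ω x => U x ω := measurable_pi_iff.2 hU_meas
  -- All claims depend only on the joint law of the labels, so they transfer from the canonical
  -- space.
  have hlaw : P.map (fun ω x => U x ω) = TreePercolation.treeMeasure d := by
    rw [hU_indep.map_fun_eq_infinitePi_map hU_meas]
    simp only [hU_law]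
    rfl
  obtain ⟨c, hc⟩ := TreePercolation.exists_isSpeedRoot hd
  refine ⟨c, hc, fun c' hc' => hc.eq hd hc', ?_, fun α hα => ?_, ?_⟩
  · have h := TreePercolation.ae_finite_and_tendsto hd hc
    rw [← hlaw] at h
    exact ae_of_ae_map hmeas.aemeasurable h
  · have h := TreePercolation.integrable_timeToInfinity hd hα
    rw [← hlaw] at h
    exact h.comp_measurable hmeas
  · have h := TreePercolation.tendsto_eLpNorm_scaled_timeToInfinity hd hc
    refine h.congr fun α => ?_
    have hm := ((TreePercolation.measurable_timeToInfinity (d := d) α).ennreal_toReal.const_mul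
      (1 - α)).sub_const c
    rw [← hlaw, eLpNorm_map_measure hm.aestronglyMeasurable hmeas.aemeasurable]
    rfl
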